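/- Let $n\ge 3$. A sum over an empty range is $0$. Define $$b_n=\min\Big\{j\in\{2,\dots,n\}:\ \sum_{i=j+1}^n\frac1{i-2}\le\frac12\Big\},\qquad u_n=(b_n-2)(2n-4)\sum_{i=b_n}^n\frac1{i-2},$$ $$f_n(x)=3x^2-(1+4n)x+(n-2)b_n+2(n+1)+u_n,\qquad a_n=\min\{j\in\{2,\dots,n\}:\ f_n(j)\le 0\}.$$ Let $(R_1,\dots,R_n)$ (the absolute ranks of $n$ candidates, in order of interview) be random on a probability space and equal to each permutation of $(1,\dots,n)$ with probability $1/n!$. Let $X_j=|\{1\le i\le j: R_i\le R_j\}|$ be the relative rank of the $j$-th candidate among the first $j$, and let $\mathcal M_n$ be the set of all stopping times $\tau$ with values in $\{1,\dots,n\}$ with respect to the filtration $\mathcal F_j=\sigma(X_1,\dots,X_j)$, $1\le j\le n$. Then both sets of indices above are non-empty, so that $b_n$ and $a_n$ are well defined; $f_n$ has two distinct real roots, and $a_n$ is the ceiling of the smaller one; and $a_n<b_n$. Furthermore, with the convention $\min\emptyset:=n$, the rule $$\tau_{3,n}=\min\Big\{\min\{a_n\le j\le n: X_j=2\},\ \min\{b_n\le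 j\le n: X_j=3\}\Big\}$$ belongs to $\mathcal M_n$ and maximizes the probability of selecting the 3rd best candidate: $$P(R_{\tau_{3,n}}=3)=\max_{\tau\in\mathcal M_n}P(R_\tau=3).$$ -/

import Mathlib

open MeasureTheory

noncomputable section

namespace ThirdBest

/-! ### The thresholds -/

/-- The indices `j ∈ {2, …, n}` with `∑_{i=j+1}^n 1/(i-2) ≤ 1/2`. -/
def bSet (n : ℕ) : Set ℕ :=
  {j | 2 ≤ j ∧ j ≤ n ∧ ∑ i ∈ Finset.Icc (j + 1) n, 1 / ((i : ℝ) - 2) ≤ 1 / 2}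

/-- The threshold `b_n`, the minimum of `bSet n`. -/
def b (n : ℕ) : ℕ := sInf (bSet n)

/-- `u_n = (b_n - 2)(2n - 4) ∑_{i=b_n}^n 1/(i-2)`. -/
def u (n : ℕ) : ℝ :=
  ((b n : ℝ) - 2) * (2 * (n : ℝ) - 4) * ∑ i ∈ Finset.Icc (b n) n, 1 / ((i : ℝ) - 2)

/-- `f_n(x) = 3x² - (1 + 4n)x + (n - 2)b_n + 2(n + 1) + u_n`. -/
def f (n : ℕ) (x : ℝ) : ℝ :=
  3 * x ^ 2 - (1 + 4 * (n : ℝ)) * x + ((n : ℝ) - 2) * (b n : ℝ) + 2 * ((n : ℝ) + 1) + u n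

/-- The indices `j ∈ {2, …, n}` with `f_n(j) ≤ 0`. -/
def aSet (n : ℕ) : Set ℕ :=
  {j | 2 ≤ j ∧ j ≤ n ∧ f n (j : ℝ) ≤ 0}

/-- The threshold `a_n`, the minimum of `aSet n`. -/
def a (n : ℕ) : ℕ := sInf (aSet n)

/-! ### The secretary problem

Candidates are numbered `1, …, n` in the order of the interviews; `R j ω` is the absolute rank of
the `j`-th candidate. The values of `R` at indices outside `{1, …, n}` play no role. -/

section Model

variable {Ω : Type*}

/-- The relative rank `X_j = |{1 ≤ i ≤ j : R_i ≤ R_j}|` of the `j`-th candidate among the first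
`j` candidates. -/
def relRank (R : ℕ → Ω → ℕ) (j : ℕ) (ω : Ω) : ℕ :=
  ((Finset.Icc 1 j).filter (fun i => R i ω ≤ R j ω)).card

/-- Minimum of a finite set of times, with the convention `min ∅ := n`. -/
def minOr (n : ℕ) (S : Finset ℕ) : ℕ :=
  if h : S.Nonempty then S.min' h else n

/-- `min {c ≤ j ≤ n : X_j = x}`, with `min ∅ := n`. -/
def firstTime (n : ℕ) (R : ℕ → Ω → ℕ) (c x : ℕ) (ω : Ω) : ℕ :=
  minOr n ((Finset.Icc c n).filter (fun j => relRank R j ω = x))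

/-- The two-threshold rule
`τ_{3,n} = min {a_n ≤ j ≤ n : X_j = 2} ∧ min {b_n ≤ j ≤ n : X_j = 3}`. -/
def tau3 (n : ℕ) (R : ℕ → Ω → ℕ) (ω : Ω) : ℕ :=
  min (firstTime n R (a n) 2 ω) (firstTime n R (b n) 3 ω)

variable [MeasurableSpace Ω]

/-- `(R_1, …, R_n)` is a random vector that equals `(σ(1), …, σ(n))` with probability `1/n!` for
every permutation `σ` of `{1, …, n}` (permutations of `Fin n = {0, …, n-1}` are shifted by one). -/
structure IsUniformRanking (n : ℕ) (P : Measure Ω) (R : ℕ → Ω → ℕ) : Prop where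
  measurable : ∀ j, 1 ≤ j → j ≤ n → Measurable (R j)
  law : ∀ σ : Equiv.Perm (Fin n),
    P {ω | ∀ i : Fin n, R ((i : ℕ) + 1) ω = (σ i : ℕ) + 1} = ((n.factorial : ℕ) : ENNReal)⁻¹

theorem IsUniformRanking.measurable_relRank {n : ℕ} {P : Measure Ω} {R : ℕ → Ω → ℕ}
    (hR : IsUniformRanking n P R) {j : ℕ} (hj : 1 ≤ j) (hjn : j ≤ n) :
    Measurable (relRank R j) := by
  have h : relRank R j = fun ω => ∑ i ∈ Finset.Icc 1 j, if R i ω ≤ R j ω then 1 else 0 := by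
    funext ω
    exact Finset.card_filter _ _
  rw [h]
  refine Finset.measurable_sum _ (fun i hi => ?_)
  rw [Finset.mem_Icc] at hi
  exact Measurable.ite
    (measurableSet_le (hR.measurable i hi.1 (hi.2.trans hjn)) (hR.measurable j hj hjn))
    measurable_const measurable_const

/-- The filtration `F_j = σ(X_1, …, X_j)`, `j ≤ n` (and `F_j = F_n` for `j > n`). -/
def relRankFiltration {n : ℕ} {P : Measure Ω} {R : ℕ → Ω → ℕ} (hR : IsUniformRanking n P R) :
    Filtration ℕ (inferInstance : MeasurableSpace Ω) where
  seq j := ⨆ i ∈ Finset.Icc 1 (min j n), MeasurableSpace.comap (relRank R i) ⊤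
  mono' := by
    intro j k hjk
    refine biSup_mono (fun i hi => ?_)
    rw [Finset.mem_Icc] at hi ⊢
    exact ⟨hi.1, hi.2.trans (min_le_min_right n hjk)⟩
  le' := by
    intro j
    refine iSup₂_le (fun i hi => ?_)
    rw [Finset.mem_Icc] at hi
    exact (hR.measurable_relRank hi.1 (hi.2.trans (min_le_right j n))).comap_le

/-- The class `M_n` of stopping rules: stopping times with values in `{1, …, n}` with respect to
the filtration generated by the relative ranks. -/
def IsStoppingRule {n : ℕ} {P : Measure Ω} {R : ℕ → Ω → ℕ} (hR : IsUniformRanking n P R)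
    (τ : Ω → ℕ) : Prop :=
  (∀ ω, 1 ≤ τ ω ∧ τ ω ≤ n) ∧
    IsStoppingTime (relRankFiltration hR) (fun ω => ((τ ω : ℕ) : WithTop ℕ))

/-- `P(R_τ = 3)`, the probability that the rule `τ` selects the third best candidate. -/
def probThird (P : Measure Ω) (R : ℕ → Ω → ℕ) (τ : Ω → ℕ) : ENNReal :=
  P {ω | R (τ ω) ω = 3}

end Model

end ThirdBest

end

/-!
The problem is optimal stopping of the independent relative ranks `X_j`, each uniform on
`{1, …, j}`, and the proof is backward induction made explicit.

*Probability.* Let `Y_k` be the rank of the `j`-th candidate among the first `k`. Then `Y_j = X_j`,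
`Y_n = R_j` and `Y_{k+1} = Y_k + 1` or `Y_k` according to whether `X_{k+1} ≤ Y_k` or not
(`rankAmong_succ`). So the relative ranks determine the permutation, and by counting every vector of
relative ranks is taken by exactly one permutation. Exchanging two values of a single `X_{j+1}` is
then a bijection of the permutations, which gives uniformity and independence of the past
(`prob_relRank_succ`). The recursion for `Y_k` also shows that on `X_j = x` the conditional
probability of `R_j = 3` given `F_j` is `gain n j x` (`prob_rank_eq_three`). With `value` defined by
the Bellman recursion, `value n 1 - P(R_τ = 3)` is a sum of nonnegative losses, one for each possible
decision of `τ` (`value_one_sub_probThird`, `backward_step`), and it vanishes if `τ` stops only where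
`value n (j + 1) ≤ gain n j x` and continues only where the reverse inequality holds.

*The stopping region.* Put `D = n(n-1)(n-2)` and `T_j = ∑_{i=j}^n 1/(i-2)`. From `b_n` on the value
is `(j-1)(j-2) w_j / D` with `w_j = (2n-4) T_j - (n+1-j)` (`lateValue`), and stopping at relative
rank `3` is right exactly when `T_{j+1} ≤ 1/2`. For `j ≤ b_n` the rule that uses only relative
rank `2` before `b_n` has value `(j-1) v_j / D` (`earlyValue`), and
`D * gain n j 2 - j v_{j+1} = - j f_n(j)` (`gain_two_eq_sub_f`), so the sign of `f_n` decides about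
relative rank `2`. The remaining comparisons rest on two estimates. Since every term of `T_j` is at
least `1/(n-2)`, the definition of `b_n` gives `2 (b_n - 2) ≥ n - 2` (`add_two_le_two_mul_b`). On
`[(n-2)/2, n-2]` the function `1/t` lies below its chord, which gives
`(2n-4) T_j ≤ 3 (n+1-j)` for the relevant `j` (`tail_mul_le`); at `j = b_n` this is
`f_n(b_n - 1) ≤ 0`, hence `a_n < b_n` and, by convexity, `f_n ≤ 0` on `[a_n, b_n - 1]`.
-/

noncomputable section

namespace ThirdBest

/-! ### The thresholds `b_n` and `a_n` -/

/-- The tail `∑_{i=j}^n 1/(i-2)` of the harmonic sum that defines the thresholds. -/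
def tail (n j : ℕ) : ℝ := ∑ i ∈ Finset.Icc j n, 1 / ((i : ℝ) - 2)

theorem tail_succ_self (n : ℕ) : tail n (n + 1) = 0 := by
  simp [tail]

theorem tail_eq_add {n j : ℕ} (hj : j ≤ n) : tail n j = 1 / ((j : ℝ) - 2) + tail n (j + 1) := by
  unfold tail
  rw [← Finset.insert_Icc_add_one_left_eq_Icc hj, Finset.sum_insert (by simp)]

theorem tail_antitone {n j k : ℕ} (hj : 3 ≤ j) (hjk : j ≤ k) : tail n k ≤ tail n j := by
  refine Finset.sum_le_sum_of_subset_of_nonneg (Finset.Icc_subset_Icc_left hjk) ?_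
  intro i hi _
  rw [Finset.mem_Icc] at hi
  have : (3 : ℝ) ≤ i := by exact_mod_cast hj.trans hi.1
  exact one_div_nonneg.mpr (by linarith)

/-- Each of the `n + 1 - j` terms of the tail is at least `1/(n-2)`. -/
theorem le_tail_mul {n j : ℕ} (hj : 3 ≤ j) (hjn : j ≤ n + 1) :
    (n : ℝ) + 1 - j ≤ tail n j * (n - 2) := by
  induction hjn using Nat.decreasingInduction with
  | self => simp [tail_succ_self]
  | of_succ k hk ih =>
    have ih := ih (by omega)
    have h3 : (3 : ℝ) ≤ k := by exact_mod_cast hj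
    have hkn : (k : ℝ) ≤ n := by exact_mod_cast (by omega : k ≤ n)
    rw [tail_eq_add (by omega)]
    have : 1 ≤ 1 / ((k : ℝ) - 2) * (n - 2) := by
      rw [one_div_mul_eq_div, le_div_iff₀ (by linarith)]
      linarith
    push_cast at ih
    linarith

/-- On `[m/2, m]` with `m = n - 2` the convex function `t ↦ 1/t` lies below its chord
`t ↦ (3m - 2t)/m²`; the right-hand side is the sum of the chord. -/
theorem tail_mul_sq_le {n j : ℕ} (hj : 3 ≤ j) (hjn : j ≤ n + 1) (hh : n + 2 ≤ 2 * j) :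
    tail n j * ((n : ℝ) - 2) ^ 2 ≤ (n + 1 - j) * (2 * n - 2 - j) := by
  induction hjn using Nat.decreasingInduction with
  | self => simp [tail_succ_self]
  | of_succ k hk ih =>
    have ih := ih (by omega) (by omega)
    have h3 : (3 : ℝ) ≤ k := by exact_mod_cast hj
    have hkn : (k : ℝ) ≤ n := by exact_mod_cast (by omega : k ≤ n)
    have hh' : (n : ℝ) + 2 ≤ 2 * k := by exact_mod_cast hh
    rw [tail_eq_add (by omega)]
    have : 1 / ((k : ℝ) - 2) * (n - 2) ^ 2 ≤ 3 * (n - 2) - 2 * (k - 2) := by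
      rw [one_div_mul_eq_div, div_le_iff₀ (by linarith)]
      nlinarith [mul_nonneg (sub_nonneg.2 hh') (sub_nonneg.2 hkn)]
    push_cast at ih
    linarith

theorem tail_mul_le {n j : ℕ} (hn : 3 ≤ n) (hj : 3 ≤ j) (hjn : j ≤ n + 1) (hh : n + 2 ≤ 2 * j) :
    tail n j * (2 * n - 4) ≤ 3 * ((n : ℝ) + 1 - j) := by
  have h := tail_mul_sq_le hj hjn hh
  have hn' : (3 : ℝ) ≤ n := by exact_mod_cast hn
  have hh' : (n : ℝ) + 2 ≤ 2 * j := by exact_mod_cast hh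
  have hjn' : (j : ℝ) ≤ n + 1 := by exact_mod_cast hjn
  refine le_of_mul_le_mul_right ?_ (by linarith : (0 : ℝ) < n - 2)
  nlinarith [mul_nonneg (sub_nonneg.2 hjn') (sub_nonneg.2 hh')]

theorem isLeast_b {n : ℕ} (hn : 3 ≤ n) : IsLeast (bSet n) (b n) := by
  have : n ∈ bSet n := ⟨by omega, le_rfl, by simp⟩
  exact ⟨Nat.sInf_mem ⟨n, this⟩, fun _ h => Nat.sInf_le h⟩

theorem b_le {n : ℕ} (hn : 3 ≤ n) : b n ≤ n := (isLeast_b hn).1.2.1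

theorem tail_b_succ_le {n : ℕ} (hn : 3 ≤ n) : tail n (b n + 1) ≤ 1 / 2 := (isLeast_b hn).1.2.2

theorem three_le_b {n : ℕ} (hn : 3 ≤ n) : 3 ≤ b n := by
  have h2 : 2 ≤ b n := (isLeast_b hn).1.1
  by_contra hlt
  have hb : b n = 2 := by omega
  have h1 := tail_b_succ_le hn
  have h := le_tail_mul (n := n) (j := 3) le_rfl (by omega)
  have hn' : (3 : ℝ) ≤ n := by exact_mod_cast hn
  rw [hb] at h1
  push_cast at h
  nlinarith

theorem half_lt_tail_b {n : ℕ} (hn : 3 ≤ n) : 1 / 2 < tail n (b n) := by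
  have h3 := three_le_b hn
  by_contra! h
  have hmem : b n - 1 ∈ bSet n := by
    refine ⟨by omega, (Nat.sub_le _ _).trans (b_le hn), ?_⟩
    rwa [Nat.sub_add_cancel (by omega)]
  have := (isLeast_b hn).2 hmem
  omega

/-- Every term of the tail beyond `b_n` is at least `1/(n-2)`, so a tail of at most `1/2` has at
most `(n-2)/2` terms. -/
theorem add_two_le_two_mul_b {n : ℕ} (hn : 3 ≤ n) : n + 2 ≤ 2 * b n := by
  have h3 := three_le_b hn
  have h := le_tail_mul (n := n) (j := b n + 1) (by omega) (by have := b_le hn; omega)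
  have h1 := tail_b_succ_le hn
  have hn' : (3 : ℝ) ≤ n := by exact_mod_cast hn
  push_cast at h
  have : (n : ℝ) + 2 ≤ 2 * b n := by nlinarith
  exact_mod_cast this

theorem u_eq (n : ℕ) : u n = ((b n : ℝ) - 2) * (2 * n - 4) * tail n (b n) := rfl

/-- `f_n(b_n - 1) ≤ 0` is the bound `tail_mul_le` at `b_n`, multiplied by `b_n - 2`. -/
theorem f_b_sub_one_nonpos {n : ℕ} (hn : 3 ≤ n) : f n ((b n : ℝ) - 1) ≤ 0 := by
  have h3 := three_le_b hn
  have h := tail_mul_le hn h3 ((b_le hn).trans (Nat.le_succ n)) (add_two_le_two_mul_b hn)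
  have h3' : (3 : ℝ) ≤ b n := by exact_mod_cast h3
  unfold f
  rw [u_eq]
  nlinarith [mul_le_mul_of_nonneg_left h (by linarith : (0 : ℝ) ≤ b n - 2)]

theorem f_one_pos {n : ℕ} (hn : 3 ≤ n) : 0 < f n 1 := by
  have h3' : (3 : ℝ) ≤ b n := by exact_mod_cast three_le_b hn
  have hn' : (3 : ℝ) ≤ n := by exact_mod_cast hn
  have h := half_lt_tail_b hn
  have hu : 0 ≤ u n := by
    rw [u_eq]
    exact mul_nonneg (mul_nonneg (by linarith) (by linarith)) (by linarith)
  unfold f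
  nlinarith [mul_pos (by linarith : (0 : ℝ) < n - 2) (by linarith : (0 : ℝ) < b n - 2)]

theorem b_sub_one_mem_aSet {n : ℕ} (hn : 3 ≤ n) : b n - 1 ∈ aSet n := by
  have h3 := three_le_b hn
  refine ⟨by omega, (Nat.sub_le _ _).trans (b_le hn), ?_⟩
  rw [Nat.cast_sub (by omega)]
  simpa using f_b_sub_one_nonpos hn

theorem isLeast_a {n : ℕ} (hn : 3 ≤ n) : IsLeast (aSet n) (a n) :=
  ⟨Nat.sInf_mem ⟨_, b_sub_one_mem_aSet hn⟩, fun _ h => Nat.sInf_le h⟩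

theorem two_le_a {n : ℕ} (hn : 3 ≤ n) : 2 ≤ a n := (isLeast_a hn).1.1

theorem a_lt_b {n : ℕ} (hn : 3 ≤ n) : a n < b n := by
  have h := (isLeast_a hn).2 (b_sub_one_mem_aSet hn)
  have := three_le_b hn
  omega

/-- The quadratic `f_n` is convex, hence nonpositive between `a_n` and `b_n - 1`. -/
theorem f_nonpos {n j : ℕ} (hn : 3 ≤ n) (ha : a n ≤ j) (hb : j < b n) : f n j ≤ 0 := by
  have h1 : f n (a n) ≤ 0 := (isLeast_a hn).1.2.2
  have h2 := f_b_sub_one_nonpos hn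
  have ha' : (a n : ℝ) ≤ j := by exact_mod_cast ha
  have hb' : (j : ℝ) + 1 ≤ b n := by exact_mod_cast hb
  rcases eq_or_lt_of_le (by linarith : (a n : ℝ) ≤ b n - 1) with h | h
  · rwa [le_antisymm (by linarith) ha']
  · refine le_of_mul_le_mul_right ?_ (sub_pos.2 h)
    have e1 := mul_le_mul_of_nonneg_left h1 (by linarith : (0 : ℝ) ≤ b n - 1 - j)
    have e2 := mul_le_mul_of_nonneg_left h2 (by linarith : (0 : ℝ) ≤ j - a n)
    have e3 := mul_nonneg (mul_nonneg (by linarith : (0 : ℝ) ≤ b n - 1 - j)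
      (by linarith : (0 : ℝ) ≤ j - a n)) (sub_pos.2 h).le
    unfold f at e1 e2 ⊢
    linear_combination e1 + e2 + 3 * e3

theorem f_pos {n j : ℕ} (hn : 3 ≤ n) (hj : 1 ≤ j) (ha : j < a n) : 0 < f n j := by
  rcases eq_or_lt_of_le hj with rfl | hj
  · simpa using f_one_pos hn
  · by_contra! h
    have := (isLeast_a hn).2 (show j ∈ aSet n from
      ⟨hj, ha.le.trans (isLeast_a hn).1.2.1, h⟩)
    omega

theorem exists_roots_f {n : ℕ} (hn : 3 ≤ n) :
    ∃ x₀ y₀ : ℝ, x₀ < y₀ ∧ (∀ x : ℝ, f n x = 0 ↔ x = x₀ ∨ x = y₀) ∧ ((a n : ℕ) : ℤ) = ⌈x₀⌉ := by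
  set p : ℝ := (1 + 4 * n) / 6 with hp
  set c : ℝ := f n p with hc
  have hsq : ∀ x, f n x = 3 * (x - p) ^ 2 + c := by
    intro x
    rw [hc, hp]
    unfold f
    ring
  -- The vertex `(1 + 4n)/6` is not an integer, so `f_n(b_n - 1) ≤ 0` forces `f_n < 0` there.
  have hne : (b n : ℝ) - 1 ≠ p := by
    intro h
    rw [hp] at h
    have h' : 6 * (b n : ℝ) = 7 + 4 * n := by linarith
    have h'' : 6 * b n = 7 + 4 * n := by exact_mod_cast h'
    omega
  have hc0 : c < 0 := by
    have h := f_b_sub_one_nonpos hn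
    rw [hsq] at h
    have := sq_pos_of_ne_zero (sub_ne_zero.2 hne)
    linarith
  set s := √(-c / 3) with hs
  have hs0 : 0 < s := Real.sqrt_pos.2 (by linarith)
  have hs2 : s ^ 2 = -c / 3 := Real.sq_sqrt (by linarith)
  have hfac : ∀ x, f n x = 3 * ((x - (p - s)) * (x - (p + s))) := by
    intro x
    rw [hsq]
    linear_combination 3 * hs2
  refine ⟨p - s, p + s, by linarith, ?_, ?_⟩
  · intro x
    rw [hfac]
    simp [sub_eq_zero]
  · have hneg : ∀ x, p - s ≤ x → x ≤ p + s → f n x ≤ 0 := by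
      intro x h1 h2
      rw [hfac]
      nlinarith [mul_nonneg (sub_nonneg.2 h1) (sub_nonneg.2 h2)]
    have hbet : ∀ x, f n x ≤ 0 → p - s ≤ x ∧ x ≤ p + s := by
      intro x hx
      rw [hfac] at hx
      constructor <;> by_contra! h <;> nlinarith
    have h1 := hbet _ (isLeast_a hn).1.2.2
    have h2 := two_le_a hn
    symm
    rw [Int.ceil_eq_iff]
    push_cast
    refine ⟨?_, h1.1⟩
    by_contra! h
    have h3 := f_pos hn (show 1 ≤ a n - 1 by omega) (by omega)
    rw [Nat.cast_sub (by omega), Nat.cast_one] at h3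
    linarith [hneg _ h (by linarith [h1.2])]

/-! ### The value function -/

/-- The conditional probability `P(R_j = 3 ∣ X_1, …, X_j)` on `X_j = x`, for `1 ≤ x ≤ j ≤ n`, that
is `C(2, x-1) C(n-3, j-x) / C(n, j)`. -/
def gain (n j x : ℕ) : ℝ :=
  (if x = 1 then (j : ℝ) * (n - j) * (n - j - 1)
    else if x = 2 then 2 * (j : ℝ) * (j - 1) * (n - j)
    else if x = 3 then (j : ℝ) * (j - 1) * (j - 2)
    else 0) / ((n : ℝ) * (n - 1) * (n - 2))

/-- The value of the optimal stopping problem when `k` candidates remain, by backward induction. -/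
def valueRem (n : ℕ) : ℕ → ℝ
  | 0 => 0
  | k + 1 => (∑ x ∈ Finset.Icc 1 (n - k), max (gain n (n - k) x) (valueRem n k)) / ((n - k : ℕ) : ℝ)

/-- The value of the optimal stopping problem just before the `j`-th interview, when none of the
earlier candidates has been selected. -/
def value (n j : ℕ) : ℝ := valueRem n (n + 1 - j)

theorem denom_pos {n : ℕ} (hn : 3 ≤ n) : (0 : ℝ) < n * (n - 1) * (n - 2) := by
  have hn' : (3 : ℝ) ≤ n := by exact_mod_cast hn
  exact mul_pos (mul_pos (by linarith) (by linarith)) (by linarith)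

theorem gain_last {n : ℕ} (x : ℕ) (hn : 3 ≤ n) : gain n n x = if x = 3 then 1 else 0 := by
  have hD := (denom_pos hn).ne'
  unfold gain
  split_ifs <;> first | omega | exact div_self hD | simp

/-- The next candidate is ranked above a candidate of relative rank `x` among `k` with
probability `x/(k+1)`. -/
theorem gain_recursion {n k x : ℕ} (hx : 1 ≤ x) :
    ((k : ℝ) + 1) * gain n k x =
      x * gain n (k + 1) (x + 1) + ((k : ℝ) + 1 - x) * gain n (k + 1) x := by
  unfold gain
  obtain rfl | rfl | rfl | h : x = 1 ∨ x = 2 ∨ x = 3 ∨ 4 ≤ x := by omega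
  · push_cast
    simp
    ring
  · push_cast
    simp
    ring
  · push_cast
    simp
    ring
  · rw [if_neg (by omega), if_neg (by omega), if_neg (by omega), if_neg (by omega),
      if_neg (by omega), if_neg (by omega), if_neg (by omega), if_neg (by omega),
      if_neg (by omega)]
    simp

theorem value_succ_self (n : ℕ) : value n (n + 1) = 0 := by
  simp [value, valueRem]

theorem mul_value {n j : ℕ} (hj : 1 ≤ j) (hjn : j ≤ n) :
    j * value n j = ∑ x ∈ Finset.Icc 1 j, max (gain n j x) (value n (j + 1)) := by
  have h : n + 1 - j = (n - j) + 1 := by omega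
  have h' : n - (n - j) = j := by omega
  have hj0 : (j : ℝ) ≠ 0 := by exact_mod_cast (by omega : j ≠ 0)
  rw [value, value, h, valueRem, h', mul_div_cancel₀ _ hj0]
  simp

theorem value_nonneg {n j : ℕ} (hj : 1 ≤ j) (hjn : j ≤ n + 1) : 0 ≤ value n j := by
  induction hjn using Nat.decreasingInduction with
  | self => rw [value_succ_self]
  | of_succ k hk ih =>
    have ih := ih (by omega)
    have h := mul_value hj (by omega : k ≤ n)
    have : (0 : ℝ) < k := by exact_mod_cast hj
    refine nonneg_of_mul_nonneg_right ?_ this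
    rw [h]
    exact Finset.sum_nonneg fun x _ => ih.trans (le_max_right _ _)

/-- `n(n-1)(n-2)/((j-1)(j-2))` times the value, at time `j > 2`, of the rule that from then on stops
at relative ranks `2` and `3`. -/
def lateValue (n j : ℕ) : ℝ := (2 * n - 4) * tail n j - (n + 1 - j)

/-- `n(n-1)(n-2)/(j-1)` times the value, at time `2 ≤ j ≤ b_n`, of the rule that from then on stops
at relative rank `2`, and from time `b_n` on also at relative rank `3`. -/
def earlyValue (n j : ℕ) : ℝ :=
  ((b n : ℝ) - 2) * lateValue n (b n) + ((b n : ℝ) - j) * (2 * n + 1 - b n - j)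

theorem lateValue_eq_add {n j : ℕ} (hj : 3 ≤ j) (hjn : j ≤ n) :
    ((j : ℝ) - 2) * lateValue n j = ((j : ℝ) - 2) * lateValue n (j + 1) + (2 * n - j - 2) := by
  have hj' : (3 : ℝ) ≤ j := by exact_mod_cast hj
  have hne : (j : ℝ) - 2 ≠ 0 := by linarith
  unfold lateValue
  rw [tail_eq_add hjn]
  push_cast
  field_simp
  ring

theorem gain_one (n j : ℕ) :
    gain n j 1 = (j : ℝ) * (n - j) * (n - j - 1) / ((n : ℝ) * (n - 1) * (n - 2)) := by
  simp [gain]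

theorem gain_two (n j : ℕ) :
    gain n j 2 = 2 * (j : ℝ) * (j - 1) * (n - j) / ((n : ℝ) * (n - 1) * (n - 2)) := by
  simp [gain]

theorem gain_three (n j : ℕ) :
    gain n j 3 = (j : ℝ) * (j - 1) * (j - 2) / ((n : ℝ) * (n - 1) * (n - 2)) := by
  simp [gain]

theorem gain_eq_zero {n j x : ℕ} (hx : 4 ≤ x) : gain n j x = 0 := by
  unfold gain
  rw [if_neg (by omega), if_neg (by omega), if_neg (by omega), zero_div]

/-- From `b_n` on it is optimal to stop exactly at the relative ranks `2` and `3`: comparison of the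
gains with the value of that rule. -/
theorem gain_compare_late {n j : ℕ} (hn : 3 ≤ n) (hb : b n ≤ j) (hjn : j ≤ n)
    (hV : value n (j + 1) = j * (j - 1) * lateValue n (j + 1) / ((n : ℝ) * (n - 1) * (n - 2))) :
    gain n j 1 ≤ value n (j + 1) ∧ value n (j + 1) ≤ gain n j 2 ∧
      value n (j + 1) ≤ gain n j 3 := by
  have h3 := three_le_b hn
  have hD := denom_pos hn
  have hn' : (3 : ℝ) ≤ n := by exact_mod_cast hn
  have hj' : (3 : ℝ) ≤ j := by exact_mod_cast h3.trans hb
  have hjn' : (j : ℝ) ≤ n := by exact_mod_cast hjn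
  have hh : (n : ℝ) + 2 ≤ 2 * j := by
    have := add_two_le_two_mul_b hn
    exact_mod_cast (by omega : n + 2 ≤ 2 * j)
  have ht1 := le_tail_mul (n := n) (j := j + 1) (by omega) (by omega)
  have ht2 := tail_mul_le (n := n) (j := j + 1) hn (by omega) (by omega)
    (by have := add_two_le_two_mul_b hn; omega)
  have ht3 := (tail_antitone (n := n) (by omega) (Nat.succ_le_succ hb)).trans (tail_b_succ_le hn)
  push_cast at ht1 ht2
  rw [hV, gain_one, gain_two, gain_three]
  have hw : lateValue n (j + 1) = tail n (j + 1) * (2 * n - 4) - (n - j) := by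
    unfold lateValue
    push_cast
    ring
  refine ⟨?_, ?_, ?_⟩ <;> refine div_le_div_of_nonneg_right ?_ hD.le
  · have h1 : (n : ℝ) - j ≤ lateValue n (j + 1) := by rw [hw]; linarith
    have h2 : ((n : ℝ) - j) * (n - j - 1) ≤ (j - 1) * lateValue n (j + 1) := by
      nlinarith
    nlinarith
  · have h1 : lateValue n (j + 1) ≤ 2 * (n - j) := by rw [hw]; linarith
    nlinarith [mul_le_mul_of_nonneg_left h1 (by nlinarith : (0 : ℝ) ≤ j * (j - 1))]
  · have h1 : lateValue n (j + 1) ≤ j - 2 := by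
      rw [hw]
      nlinarith
    exact mul_le_mul_of_nonneg_left h1 (by nlinarith : (0 : ℝ) ≤ j * (j - 1))

theorem value_late {n j : ℕ} (hn : 3 ≤ n) (hb : b n ≤ j) (hjn : j ≤ n + 1) :
    value n j = (j - 1) * (j - 2) * lateValue n j / ((n : ℝ) * (n - 1) * (n - 2)) := by
  induction hjn using Nat.decreasingInduction with
  | self => simp [value_succ_self, lateValue, tail_succ_self]
  | of_succ k hk ih =>
    have h3 := three_le_b hn
    have hV : value n (k + 1) =
        k * (k - 1) * lateValue n (k + 1) / ((n : ℝ) * (n - 1) * (n - 2)) := by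
      rw [ih (by omega)]
      push_cast
      ring
    obtain ⟨h1, h2, h3'⟩ := gain_compare_late hn hb (by omega) hV
    have hsum : ∀ x ∈ Finset.Icc 1 k, max (gain n k x) (value n (k + 1)) =
        value n (k + 1) + (if x = 2 then gain n k 2 - value n (k + 1) else 0) +
          (if x = 3 then gain n k 3 - value n (k + 1) else 0) := by
      intro x hx
      rw [Finset.mem_Icc] at hx
      obtain rfl | rfl | rfl | h : x = 1 ∨ x = 2 ∨ x = 3 ∨ 4 ≤ x := by omega
      · simp [h1]
      · simp [h2]
      · simp [h3']
      · rw [gain_eq_zero h, max_eq_right (value_nonneg (by omega) (by omega)),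
          if_neg (by omega), if_neg (by omega)]
        ring
    have hmul := mul_value (n := n) (j := k) (by omega) (by omega)
    rw [Finset.sum_congr rfl hsum, Finset.sum_add_distrib, Finset.sum_add_distrib,
      Finset.sum_ite_eq', Finset.sum_ite_eq', if_pos (Finset.mem_Icc.2 (by omega)),
      if_pos (Finset.mem_Icc.2 (by omega)), Finset.sum_const, Nat.card_Icc, nsmul_eq_mul,
      Nat.add_sub_cancel, gain_two, gain_three, hV] at hmul
    have hk0 : (k : ℝ) ≠ 0 := by exact_mod_cast (by omega : k ≠ 0)
    have hrec := lateValue_eq_add (n := n) (j := k) (by omega) (by omega)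
    have hD := (denom_pos hn).ne'
    refine mul_left_cancel₀ hk0 (hmul.trans ?_)
    rw [mul_assoc ((k : ℝ) - 1), hrec]
    generalize (n : ℝ) * (n - 1) * (n - 2) = D at hD ⊢
    field_simp
    ring

theorem b_sub_three_le_lateValue {n : ℕ} (hn : 3 ≤ n) : (b n : ℝ) - 3 ≤ lateValue n (b n) := by
  have h := half_lt_tail_b hn
  have hn' : (3 : ℝ) ≤ n := by exact_mod_cast hn
  unfold lateValue
  nlinarith

theorem le_lateValue_b {n : ℕ} (hn : 3 ≤ n) : (n : ℝ) + 1 - b n ≤ lateValue n (b n) := by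
  have h := le_tail_mul (n := n) (three_le_b hn) ((b_le hn).trans (Nat.le_succ n))
  unfold lateValue
  linarith

/-- The value is at least that of the rule described at `earlyValue`. -/
theorem le_value_early {n j : ℕ} (hn : 3 ≤ n) (hj : 2 ≤ j) (hjb : j ≤ b n) :
    (j - 1) * earlyValue n j / ((n : ℝ) * (n - 1) * (n - 2)) ≤ value n j := by
  have hbn := b_le hn
  induction hjb using Nat.decreasingInduction with
  | self =>
    rw [value_late hn le_rfl (by omega), earlyValue]
    apply le_of_eq
    ring
  | of_succ k hk ih =>
    have ih := ih (by omega)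
    have hmul := mul_value (n := n) (j := k) (by omega) (by omega)
    have hsum : ∀ x ∈ Finset.Icc 1 k,
        value n (k + 1) + (if x = 2 then gain n k 2 - value n (k + 1) else 0) ≤
          max (gain n k x) (value n (k + 1)) := by
      intro x _
      split_ifs with h
      · subst h
        simp
      · simp
    have hle := (Finset.sum_le_sum hsum).trans hmul.symm.le
    rw [Finset.sum_add_distrib, Finset.sum_ite_eq', if_pos (Finset.mem_Icc.2 (by omega)),
      Finset.sum_const, Nat.card_Icc, nsmul_eq_mul, Nat.add_sub_cancel, gain_two] at hle
    have hk0 : (2 : ℝ) ≤ k := by exact_mod_cast hj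
    have hD := (denom_pos hn).ne'
    refine le_of_mul_le_mul_left (le_trans ?_ hle) (by linarith : (0 : ℝ) < k)
    have := mul_le_mul_of_nonneg_left ih (by linarith : (0 : ℝ) ≤ k - 1)
    push_cast at this
    refine le_trans (le_of_eq ?_) (by linarith [this] :
      2 * (k : ℝ) * (k - 1) * (n - k) / ((n : ℝ) * (n - 1) * (n - 2)) + ((k : ℝ) - 1) *
        ((k + 1 - 1) * earlyValue n (k + 1) / ((n : ℝ) * (n - 1) * (n - 2))) ≤ _)
    unfold earlyValue
    generalize (n : ℝ) * (n - 1) * (n - 2) = D at hD ⊢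
    push_cast
    field_simp
    ring

/-- The relation between `f_n` and the decision to stop at relative rank `2`. -/
theorem gain_two_eq_sub_f (n j : ℕ) :
    gain n j 2 = j * earlyValue n (j + 1) / ((n : ℝ) * (n - 1) * (n - 2)) -
      j * f n j / ((n : ℝ) * (n - 1) * (n - 2)) := by
  rw [gain_two, ← sub_div]
  congr 1
  unfold earlyValue lateValue f
  rw [u_eq]
  push_cast
  ring

/-- Before `b_n` it is not optimal to stop at the relative ranks `1` and `3`. -/
theorem gain_le_value_early {n j : ℕ} (hn : 3 ≤ n) (hj : 1 ≤ j) (hjb : j < b n) :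
    gain n j 1 ≤ value n (j + 1) ∧ gain n j 3 ≤ value n (j + 1) := by
  have hV := le_value_early hn (by omega : 2 ≤ j + 1) hjb
  have hD := denom_pos hn
  have h1 := le_lateValue_b hn
  have h2 := b_sub_three_le_lateValue hn
  have hb3 : (3 : ℝ) ≤ b n := by exact_mod_cast three_le_b hn
  have hh : (n : ℝ) + 2 ≤ 2 * b n := by exact_mod_cast add_two_le_two_mul_b hn
  have hj1 : (1 : ℝ) ≤ j := by exact_mod_cast hj
  have hjb' : (j : ℝ) + 1 ≤ b n := by exact_mod_cast hjb
  have hbn : (b n : ℝ) ≤ n := by exact_mod_cast b_le hn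
  push_cast at hV
  rw [add_sub_cancel_right] at hV
  have e1 := mul_le_mul_of_nonneg_left h1 (by linarith : (0 : ℝ) ≤ b n - 2)
  have e2 := mul_le_mul_of_nonneg_left h2 (by linarith : (0 : ℝ) ≤ b n - 2)
  rw [gain_one, gain_three]
  constructor <;> refine le_trans (div_le_div_of_nonneg_right ?_ hD.le) hV <;>
    rw [mul_assoc] <;> refine mul_le_mul_of_nonneg_left ?_ (by linarith) <;>
    unfold earlyValue <;> push_cast
  -- Both sides contain the sum of `2(n - i)` over `j < i < b n`; what remains for rank `1` is
  -- `(n - b n)(n + 1 - b n) ≤ (b n - 2)(n + 1 - b n)`.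
  · nlinarith
  -- That sum is nonnegative, and `(j - 1)(j - 2) ≤ (b n - 2)(b n - 3)`.
  · nlinarith

/-- Between `a_n` and `b_n` the rule described at `earlyValue` attains the value. -/
theorem value_early {n j : ℕ} (hn : 3 ≤ n) (ha : a n ≤ j) (hjb : j ≤ b n) :
    value n j = (j - 1) * earlyValue n j / ((n : ℝ) * (n - 1) * (n - 2)) := by
  have hbn := b_le hn
  have h2a := two_le_a hn
  induction hjb using Nat.decreasingInduction with
  | self =>
    rw [value_late hn le_rfl (by omega), earlyValue]
    ring
  | of_succ k hk ih =>
    have ih := ih (by omega)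
    push_cast at ih
    have hD := denom_pos hn
    obtain ⟨h1, h3⟩ := gain_le_value_early hn (by omega : 1 ≤ k) hk
    have hk0 : (2 : ℝ) ≤ k := by exact_mod_cast h2a.trans ha
    have h2 : value n (k + 1) ≤ gain n k 2 := by
      rw [gain_two_eq_sub_f, ih]
      have := div_nonpos_of_nonpos_of_nonneg (mul_nonpos_of_nonneg_of_nonpos
        (by linarith : (0 : ℝ) ≤ k) (f_nonpos hn ha hk)) hD.le
      rw [add_sub_cancel_right]
      linarith
    have hsum : ∀ x ∈ Finset.Icc 1 k, max (gain n k x) (value n (k + 1)) =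
        value n (k + 1) + (if x = 2 then gain n k 2 - value n (k + 1) else 0) := by
      intro x hx
      rw [Finset.mem_Icc] at hx
      obtain rfl | rfl | rfl | h : x = 1 ∨ x = 2 ∨ x = 3 ∨ 4 ≤ x := by omega
      · simp [h1]
      · simp [h2]
      · simp [h3]
      · rw [gain_eq_zero h, max_eq_right (value_nonneg (by omega) (by omega)),
          if_neg (by omega), add_zero]
    have hmul := mul_value (n := n) (j := k) (by omega) (by omega)
    rw [Finset.sum_congr rfl hsum, Finset.sum_add_distrib, Finset.sum_ite_eq',
      if_pos (Finset.mem_Icc.2 (by omega)), Finset.sum_const, Nat.card_Icc, nsmul_eq_mul,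
      Nat.add_sub_cancel, gain_two, ih] at hmul
    have hk1 : (k : ℝ) ≠ 0 := by linarith
    refine mul_left_cancel₀ hk1 (hmul.trans ?_)
    have hD' := hD.ne'
    unfold earlyValue
    generalize (n : ℝ) * (n - 1) * (n - 2) = D at hD' ⊢
    push_cast
    field_simp
    ring

/-- The stopping region of the two-threshold rule: stop at time `j` at relative rank `x`. -/
def InStopRegion (n j x : ℕ) : Prop := a n ≤ j ∧ x = 2 ∨ b n ≤ j ∧ x = 3

theorem value_le_gain {n j x : ℕ} (hn : 3 ≤ n) (hjn : j ≤ n) (h : InStopRegion n j x) :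
    value n (j + 1) ≤ gain n j x := by
  have hab := a_lt_b hn
  have h2a := two_le_a hn
  have late : b n ≤ j → value n (j + 1) ≤ gain n j 2 ∧ value n (j + 1) ≤ gain n j 3 := by
    intro hb
    refine (gain_compare_late hn hb hjn ?_).2
    rw [value_late hn (by omega) (by omega)]
    push_cast
    ring
  rcases h with ⟨ha, rfl⟩ | ⟨hb, rfl⟩
  · rcases lt_or_ge j (b n) with hb | hb
    · have hk0 : (2 : ℝ) ≤ j := by exact_mod_cast h2a.trans ha
      rw [gain_two_eq_sub_f, value_early hn (by omega) hb]
      have := div_nonpos_of_nonpos_of_nonneg (mul_nonpos_of_nonneg_of_nonpos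
        (by linarith : (0 : ℝ) ≤ j) (f_nonpos hn ha hb)) (denom_pos hn).le
      push_cast
      rw [add_sub_cancel_right]
      linarith
    · exact (late hb).1
  · exact (late hb).2

theorem gain_le_value {n j x : ℕ} (hn : 3 ≤ n) (hj : 1 ≤ j) (hjn : j ≤ n) (hx : 1 ≤ x)
    (h : ¬ InStopRegion n j x) : gain n j x ≤ value n (j + 1) := by
  have hab := a_lt_b hn
  unfold InStopRegion at h
  obtain rfl | rfl | rfl | hx : x = 1 ∨ x = 2 ∨ x = 3 ∨ 4 ≤ x := by omega
  · rcases lt_or_ge j (b n) with hb | hb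
    · exact (gain_le_value_early hn hj hb).1
    · refine (gain_compare_late hn hb hjn ?_).1
      rw [value_late hn (by omega) (by omega)]
      push_cast
      ring
  · have ha : j < a n := by omega
    have hV := le_value_early hn (by omega : 2 ≤ j + 1) (by omega)
    have hf := f_pos hn hj ha
    have : 0 ≤ j * f n j / ((n : ℝ) * (n - 1) * (n - 2)) :=
      div_nonneg (mul_nonneg (Nat.cast_nonneg j) hf.le) (denom_pos hn).le
    rw [gain_two_eq_sub_f]
    push_cast at hV
    rw [add_sub_cancel_right] at hV
    linarith
  · exact (gain_le_value_early hn hj (by omega)).2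
  · rw [gain_eq_zero hx]
    exact value_nonneg (by omega) (by omega)

theorem value_le_gain_last {n : ℕ} (x : ℕ) (hn : 3 ≤ n) :
    value n (n + 1) ≤ gain n n x := by
  rw [value_succ_self, gain_last x hn]
  split_ifs <;> norm_num

/-! ### Relative ranks determine the permutation -/

section Ranks

variable {Ω : Type*} {R : ℕ → Ω → ℕ} {ω : Ω} {n : ℕ}

/-- The rank of the `j`-th candidate among the first `k`, for `j ≤ k`. -/
def rankAmong (R : ℕ → Ω → ℕ) (k j : ℕ) (ω : Ω) : ℕ :=
  ((Finset.Icc 1 k).filter (fun i => R i ω ≤ R j ω)).card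

/-- The event that the absolute ranks of the candidates are given by the permutation `σ`. -/
def rankingEvent (n : ℕ) (R : ℕ → Ω → ℕ) (σ : Equiv.Perm (Fin n)) : Set Ω :=
  {ω | ∀ i : Fin n, R ((i : ℕ) + 1) ω = (σ i : ℕ) + 1}

theorem one_le_relRank (R : ℕ → Ω → ℕ) {j : ℕ} (hj : 1 ≤ j) (ω : Ω) : 1 ≤ relRank R j ω :=
  Finset.card_pos.2 ⟨j, by simp [hj]⟩

theorem relRank_le (R : ℕ → Ω → ℕ) (j : ℕ) (ω : Ω) : relRank R j ω ≤ j :=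
  (Finset.card_filter_le _ _).trans (by simp)

theorem rank_eq {σ : Equiv.Perm (Fin n)} (h : ω ∈ rankingEvent n R σ) {i : ℕ} (hi : 1 ≤ i)
    (hin : i ≤ n) : R i ω = (σ ⟨i - 1, by omega⟩ : ℕ) + 1 := by
  have := h ⟨i - 1, by omega⟩
  rwa [Nat.sub_add_cancel hi] at this

theorem rank_injOn {σ : Equiv.Perm (Fin n)} (h : ω ∈ rankingEvent n R σ) :
    Set.InjOn (fun i => R i ω) (Finset.Icc 1 n) := by
  intro i hi j hj hij
  rw [Finset.coe_Icc, Set.mem_Icc] at hi hj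
  simp only [rank_eq h hi.1 hi.2, rank_eq h hj.1 hj.2] at hij
  have := σ.injective (Fin.ext (Nat.succ_injective hij))
  have := congrArg Fin.val this
  simp only at this
  omega

theorem rankAmong_last {σ : Equiv.Perm (Fin n)} (h : ω ∈ rankingEvent n R σ) {j : ℕ}
    (hj : 1 ≤ j) (hjn : j ≤ n) : rankAmong R n j ω = R j ω := by
  have himage : ((Finset.Icc 1 n).filter (fun i => R i ω ≤ R j ω)).image (fun i => R i ω) =
      Finset.Icc 1 (R j ω) := by
    ext r
    simp only [Finset.mem_image, Finset.mem_filter, Finset.mem_Icc]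
    constructor
    · rintro ⟨i, ⟨⟨hi, hin⟩, hle⟩, rfl⟩
      refine ⟨?_, hle⟩
      rw [rank_eq h hi hin]
      omega
    · rintro ⟨h1, h2⟩
      have hr : r - 1 < n := by
        rw [rank_eq h hj hjn] at h2
        omega
      have e : R ((σ.symm ⟨r - 1, hr⟩ : ℕ) + 1) ω = r := by
        rw [h, Equiv.apply_symm_apply]
        simp only
        omega
      refine ⟨(σ.symm ⟨r - 1, hr⟩ : ℕ) + 1, ⟨⟨by omega, (σ.symm ⟨r - 1, hr⟩).2⟩, ?_⟩, e⟩
      rwa [e]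
  rw [rankAmong, ← Finset.card_image_of_injOn ((rank_injOn h).mono ?_), himage]
  · simp
  · exact_mod_cast Finset.filter_subset _ _

/-- The relative rank of the next candidate determines how the ranks of the earlier candidates
change. -/
theorem rankAmong_succ {k j : ℕ} (hinj : Set.InjOn (fun i => R i ω) (Finset.Icc 1 (k + 1)))
    (hj : 1 ≤ j) (hjk : j ≤ k) :
    rankAmong R (k + 1) j ω =
      rankAmong R k j ω + if relRank R (k + 1) ω ≤ rankAmong R k j ω then 1 else 0 := by
  have hsucc : ∀ y, ((Finset.Icc 1 (k + 1)).filter (fun i => R i ω ≤ y)).card =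
      ((Finset.Icc 1 k).filter (fun i => R i ω ≤ y)).card + if R (k + 1) ω ≤ y then 1 else 0 := by
    intro y
    rw [← Finset.insert_Icc_right_eq_Icc_add_one (by omega), Finset.filter_insert]
    split_ifs
    · rw [Finset.card_insert_of_notMem (by simp)]
    · simp
  rw [rankAmong, hsucc]
  have hne : R j ω ≠ R (k + 1) ω := by
    intro h
    have := hinj (by simp; omega) (by simp) h
    omega
  have hiff : R (k + 1) ω ≤ R j ω ↔ relRank R (k + 1) ω ≤ rankAmong R k j ω := by
    unfold relRank rankAmong
    rw [hsucc, if_pos le_rfl]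
    constructor
    · intro h
      refine Finset.card_lt_card ⟨?_, ?_⟩
      · exact Finset.monotone_filter_right _ fun i _ hi => le_trans hi h
      · intro hsub
        have := hsub (show j ∈ _ by simp [hj, hjk])
        rw [Finset.mem_filter] at this
        omega
    · intro h
      by_contra! hlt
      have : ((Finset.Icc 1 k).filter (fun i => R i ω ≤ R j ω)).card ≤
          ((Finset.Icc 1 k).filter (fun i => R i ω ≤ R (k + 1) ω)).card :=
        Finset.card_le_card (Finset.monotone_filter_right _ fun i _ hi => le_trans hi hlt.le)
      omega
  simp only [hiff]
  rfl

/-- The canonical ranks on the space of permutations. -/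
def permRank (n : ℕ) (j : ℕ) (σ : Equiv.Perm (Fin n)) : ℕ :=
  if h : j - 1 < n then (σ ⟨j - 1, h⟩ : ℕ) + 1 else 0

theorem mem_rankingEvent_permRank (σ : Equiv.Perm (Fin n)) :
    σ ∈ rankingEvent n (permRank n) σ := by
  intro i
  simp [permRank]

theorem relRank_eq_permRank {σ : Equiv.Perm (Fin n)} (h : ω ∈ rankingEvent n R σ) {j : ℕ}
    (hj : 1 ≤ j) (hjn : j ≤ n) : relRank R j ω = relRank (permRank n) j σ := by
  have hσ := mem_rankingEvent_permRank σ
  unfold relRank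
  congr 1
  refine Finset.filter_congr fun i hi => ?_
  rw [Finset.mem_Icc] at hi
  rw [rank_eq h hi.1 (by omega), rank_eq h hj hjn, rank_eq hσ hi.1 (by omega), rank_eq hσ hj hjn]

/-- The vector of the relative ranks of a permutation, shifted by one. -/
def relRankVector (n : ℕ) (σ : Equiv.Perm (Fin n)) : ∀ i : Fin n, Fin ((i : ℕ) + 1) :=
  fun i => ⟨relRank (permRank n) (i + 1) σ - 1, by
    have := relRank_le (permRank n) (i + 1) σ
    omega⟩

/-- The absolute rank of a candidate is computed from the relative ranks by `rankAmong_succ`. -/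
theorem relRankVector_injective (n : ℕ) : Function.Injective (relRankVector n) := by
  intro σ τ h
  have hX : ∀ j, 1 ≤ j → j ≤ n → relRank (permRank n) j σ = relRank (permRank n) j τ := by
    intro j hj hjn
    have h0 := congrArg Fin.val (congrFun h ⟨j - 1, by omega⟩)
    simp only [relRankVector, Nat.sub_add_cancel hj] at h0
    have h1 := one_le_relRank (permRank n) hj σ
    have h2 := one_le_relRank (permRank n) hj τ
    omega
  have hσ := mem_rankingEvent_permRank σ
  have hτ := mem_rankingEvent_permRank τ
  have hY : ∀ j k, 1 ≤ j → j ≤ k → k ≤ n →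
      rankAmong (permRank n) k j σ = rankAmong (permRank n) k j τ := by
    intro j k hj hjk
    induction k, hjk using Nat.le_induction with
    | base => exact fun hjn => hX j hj hjn
    | succ k hjk ih =>
      intro hkn
      have hsub : (Finset.Icc 1 (k + 1) : Set ℕ) ⊆ Finset.Icc 1 n := by
        exact_mod_cast Finset.Icc_subset_Icc_right hkn
      rw [rankAmong_succ ((rank_injOn hσ).mono hsub) hj hjk,
        rankAmong_succ ((rank_injOn hτ).mono hsub) hj hjk, ih (by omega), hX _ (by omega) hkn]
  refine Equiv.ext fun i => Fin.ext ?_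
  have e := hY (i + 1) n (by omega) i.2 le_rfl
  rw [rankAmong_last hσ (by omega) i.2, rankAmong_last hτ (by omega) i.2, hσ, hτ] at e
  omega

theorem relRankVector_bijective (n : ℕ) : Function.Bijective (relRankVector n) := by
  rw [Fintype.bijective_iff_injective_and_card]
  refine ⟨relRankVector_injective n, ?_⟩
  rw [Fintype.card_perm, Fintype.card_fin, Fintype.card_pi]
  simp only [Fintype.card_fin]
  rw [Fin.prod_univ_eq_prod_range (fun i => i + 1), Finset.prod_range_add_one_eq_factorial]

theorem relRank_eq_relRankVector (σ : Equiv.Perm (Fin n)) {j : ℕ} (hj : 1 ≤ j) (hjn : j ≤ n) :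
    relRank (permRank n) j σ = (relRankVector n σ ⟨j - 1, by omega⟩ : ℕ) + 1 := by
  have := one_le_relRank (permRank n) hj σ
  simp only [relRankVector, Nat.sub_add_cancel hj]
  omega

/-- Exchanging the values `x` and `y` of one relative rank is a bijection of the permutations that
preserves all other relative ranks. -/
theorem exists_perm_exchange {j x y : ℕ} (hj : 1 ≤ j) (hjn : j ≤ n) (hx : 1 ≤ x) (hxj : x ≤ j)
    (hy : 1 ≤ y) (hyj : y ≤ j) :
    ∃ e : Equiv.Perm (Fin n) ≃ Equiv.Perm (Fin n), ∀ σ,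
      (∀ i, 1 ≤ i → i ≤ n → i ≠ j →
        relRank (permRank n) i (e σ) = relRank (permRank n) i σ) ∧
      (relRank (permRank n) j (e σ) = y ↔ relRank (permRank n) j σ = x) := by
  set Φ := Equiv.ofBijective _ (relRankVector_bijective n) with hΦ
  let s : (∀ i : Fin n, Fin ((i : ℕ) + 1)) ≃ (∀ i : Fin n, Fin ((i : ℕ) + 1)) :=
    Equiv.piCongrRight fun i =>
      if (i : ℕ) + 1 = j then Equiv.swap (Fin.ofNat _ (x - 1)) (Fin.ofNat _ (y - 1))
      else Equiv.refl _
  refine ⟨(Φ.trans s).trans Φ.symm, fun σ => ?_⟩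
  have key : relRankVector n (((Φ.trans s).trans Φ.symm) σ) = s (relRankVector n σ) :=
    Φ.apply_symm_apply (s (Φ σ))
  constructor
  · intro i hi hin hne
    rw [relRank_eq_relRankVector _ hi hin, relRank_eq_relRankVector _ hi hin, key]
    simp only [s, Equiv.piCongrRight_apply, Pi.map_apply]
    rw [if_neg (by omega), Equiv.refl_apply]
  · rw [relRank_eq_relRankVector _ hj hjn, relRank_eq_relRankVector _ hj hjn, key]
    simp only [s, Equiv.piCongrRight_apply, Pi.map_apply]
    rw [if_pos (by omega)]
    set v := relRankVector n σ ⟨j - 1, by omega⟩ with hv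
    have hxv : ∀ w : Fin (j - 1 + 1), ∀ z, 1 ≤ z → z ≤ j →
        ((w : ℕ) + 1 = z ↔ w = Fin.ofNat _ (z - 1)) := by
      intro w z hz hzj
      rw [Fin.ext_iff, Fin.val_ofNat, Nat.mod_eq_of_lt (by omega)]
      omega
    rw [hxv _ y hy hyj, hxv _ x hx hxj, Equiv.swap_apply_eq_iff, Equiv.swap_apply_right]

theorem pairwiseDisjoint_rankingEvent (n : ℕ) (R : ℕ → Ω → ℕ) (s : Set (Equiv.Perm (Fin n))) :
    s.PairwiseDisjoint (rankingEvent n R) := by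
  intro σ _ τ _ hne
  refine Set.disjoint_left.2 fun ω hσ hτ => hne ?_
  refine Equiv.ext fun i => Fin.ext ?_
  have := (hσ i).symm.trans (hτ i)
  omega

end Ranks

/-! ### The law of the relative ranks -/

section Law

variable {Ω : Type*} [MeasurableSpace Ω] {P : Measure Ω} {R : ℕ → Ω → ℕ} {n : ℕ}

theorem measurableSet_rankingEvent (hR : IsUniformRanking n P R) (σ : Equiv.Perm (Fin n)) :
    MeasurableSet (rankingEvent n R σ) := by
  have : rankingEvent n R σ = ⋂ i : Fin n, R ((i : ℕ) + 1) ⁻¹' {(σ i : ℕ) + 1} := by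
    ext ω
    simp [rankingEvent]
  rw [this]
  exact MeasurableSet.iInter fun i =>
    hR.measurable _ (by omega) i.2 (measurableSet_singleton _)

/-- The first `j` relative ranks, as a sequence that vanishes elsewhere. -/
def relRankPrefix (n : ℕ) {Ω : Type*} (R : ℕ → Ω → ℕ) (j : ℕ) (ω : Ω) : ℕ → ℕ :=
  fun i => if i ∈ Finset.Icc 1 (min j n) then relRank R i ω else 0

theorem exists_eq_preimage_relRankPrefix (hR : IsUniformRanking n P R) {j : ℕ} {A : Set Ω}
    (hA : MeasurableSet[relRankFiltration hR j] A) : ∃ S, A = relRankPrefix n R j ⁻¹' S := by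
  have hle : relRankFiltration hR j ≤ MeasurableSpace.comap (relRankPrefix n R j) ⊤ := by
    refine iSup₂_le fun i hi => ?_
    have : relRank R i = (fun v => v i) ∘ relRankPrefix n R j := by
      funext ω
      simp only [Function.comp_apply, relRankPrefix, if_pos hi]
    rw [this, ← MeasurableSpace.comap_comp]
    exact MeasurableSpace.comap_mono le_top
  obtain ⟨S, -, hS⟩ := hle A hA
  exact ⟨S, hS.symm⟩

theorem measurableSet_relRank_eq (hR : IsUniformRanking n P R) {i j : ℕ} (hi : 1 ≤ i)
    (hij : i ≤ j) (hin : i ≤ n) (s : Set ℕ) :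
    MeasurableSet[relRankFiltration hR j] {ω | relRank R i ω ∈ s} := by
  have hle : MeasurableSpace.comap (relRank R i) ⊤ ≤ relRankFiltration hR j :=
    le_iSup₂_of_le (f := fun i (_ : i ∈ Finset.Icc 1 (min j n)) =>
      MeasurableSpace.comap (relRank R i) ⊤) i (by simp [hi, hij, hin]) le_rfl
  exact hle _ ⟨s, trivial, rfl⟩

variable [IsProbabilityMeasure P]

theorem ae_mem_rankingEvent (hR : IsUniformRanking n P R) :
    ∀ᵐ ω ∂P, ∃ σ, ω ∈ rankingEvent n R σ := by
  have h : P (⋃ σ ∈ (Finset.univ : Finset (Equiv.Perm (Fin n))), rankingEvent n R σ) = 1 := by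
    rw [measure_biUnion_finset (pairwiseDisjoint_rankingEvent n R _)
      fun σ _ => measurableSet_rankingEvent hR σ]
    have hlaw : ∀ σ, P (rankingEvent n R σ) = ((n.factorial : ℕ) : ENNReal)⁻¹ := hR.law
    rw [Finset.sum_congr rfl fun σ _ => hlaw σ, Finset.sum_const, Finset.card_univ,
      Fintype.card_perm, Fintype.card_fin, nsmul_eq_mul]
    exact ENNReal.mul_inv_cancel (by exact_mod_cast n.factorial_ne_zero) (by simp)
  have h' := (prob_compl_eq_zero_iff (Finset.measurableSet_biUnion _
    fun σ _ => measurableSet_rankingEvent hR σ)).2 h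
  filter_upwards [measure_eq_zero_iff_ae_notMem.1 h'] with ω hω
  simpa using hω

/-- Probabilities of events in the ranks are counts of permutations. -/
theorem prob_eq_card (hR : IsUniformRanking n P R) {B : Set Ω} {q : Equiv.Perm (Fin n) → Prop}
    [DecidablePred q] (hB : ∀ σ, ∀ ω ∈ rankingEvent n R σ, (ω ∈ B ↔ q σ)) :
    P.real B = (Finset.univ.filter q).card / (n.factorial : ℝ) := by
  have hae : B =ᵐ[P] ⋃ σ ∈ Finset.univ.filter q, rankingEvent n R σ := by
    filter_upwards [ae_mem_rankingEvent hR] with ω hω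
    obtain ⟨σ, hσ⟩ := hω
    refine propext ?_
    change ω ∈ B ↔ ω ∈ ⋃ σ ∈ Finset.univ.filter q, rankingEvent n R σ
    rw [hB σ ω hσ]
    simp only [Finset.mem_filter, Finset.mem_univ, true_and, Set.mem_iUnion, exists_prop]
    exact ⟨fun h => ⟨σ, h, hσ⟩, fun ⟨τ, h, hτ⟩ => (hB σ ω hσ).1 ((hB τ ω hτ).2 h)⟩
  rw [measureReal_congr hae, measureReal_biUnion_finset (pairwiseDisjoint_rankingEvent n R _)
    fun σ _ => measurableSet_rankingEvent hR σ]
  have : ∀ σ ∈ Finset.univ.filter q, P.real (rankingEvent n R σ) = (n.factorial : ℝ)⁻¹ := by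
    intro σ _
    rw [measureReal_def, rankingEvent, hR.law σ]
    simp
  rw [Finset.sum_congr rfl this, Finset.sum_const, nsmul_eq_mul, div_eq_mul_inv]

theorem sum_prob_relRank_eq (hR : IsUniformRanking n P R) {j : ℕ} (hj : 1 ≤ j) (hjn : j ≤ n)
    {C : Set Ω} (hC : MeasurableSet C) (s : Finset ℕ) :
    ∑ x ∈ s, P.real (C ∩ {ω | relRank R j ω = x}) = P.real (C ∩ {ω | relRank R j ω ∈ s}) := by
  rw [← measureReal_biUnion_finset]
  · congr 1
    ext ω
    simp
  · intro x _ y _ hxy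
    refine Set.disjoint_left.2 fun ω h h' => hxy ?_
    exact h.2.symm.trans h'.2
  · intro x _
    exact hC.inter (hR.measurable_relRank hj hjn (measurableSet_singleton x))

theorem sum_prob_relRank_eq_all (hR : IsUniformRanking n P R) {j : ℕ} (hj : 1 ≤ j)
    (hjn : j ≤ n) {C : Set Ω} (hC : MeasurableSet C) :
    ∑ x ∈ Finset.Icc 1 j, P.real (C ∩ {ω | relRank R j ω = x}) = P.real C := by
  rw [sum_prob_relRank_eq hR hj hjn hC]
  congr 1
  refine Set.inter_eq_left.2 fun ω _ => ?_
  exact Finset.mem_Icc.2 ⟨one_le_relRank R hj ω, relRank_le R j ω⟩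

/-- The relative rank `X_{j+1}` is uniform on `{1, …, j+1}` and independent of `X_1, …, X_j`. -/
theorem prob_relRank_succ (hR : IsUniformRanking n P R) {j x : ℕ} (hjn : j < n) (hx : 1 ≤ x)
    (hxj : x ≤ j + 1) {A : Set Ω} (hA : MeasurableSet[relRankFiltration hR j] A) :
    ((j : ℝ) + 1) * P.real (A ∩ {ω | relRank R (j + 1) ω = x}) = P.real A := by
  classical
  obtain ⟨S, rfl⟩ := exists_eq_preimage_relRankPrefix hR hA
  have hcard : ∀ y, P.real (relRankPrefix n R j ⁻¹' S ∩ {ω | relRank R (j + 1) ω = y}) =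
      (Finset.univ.filter (fun σ : Equiv.Perm (Fin n) =>
        relRankPrefix n (permRank n) j σ ∈ S ∧ relRank (permRank n) (j + 1) σ = y)).card /
        (n.factorial : ℝ) := by
    intro y
    refine prob_eq_card hR (q := fun σ => relRankPrefix n (permRank n) j σ ∈ S ∧
      relRank (permRank n) (j + 1) σ = y) fun σ ω hω => ?_
    have hp : relRankPrefix n R j ω = relRankPrefix n (permRank n) j σ := by
      funext i
      unfold relRankPrefix
      split_ifs with hi
      · rw [Finset.mem_Icc] at hi
        exact relRank_eq_permRank hω hi.1 (by omega)
      · rfl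
    simp only [Set.mem_inter_iff, Set.mem_preimage, Set.mem_ofPred_eq, hp]
    rw [relRank_eq_permRank hω (by omega) hjn]
  have hconst : ∀ y ∈ Finset.Icc 1 (j + 1),
      P.real (relRankPrefix n R j ⁻¹' S ∩ {ω | relRank R (j + 1) ω = y}) =
        P.real (relRankPrefix n R j ⁻¹' S ∩ {ω | relRank R (j + 1) ω = x}) := by
    intro y hy
    rw [Finset.mem_Icc] at hy
    obtain ⟨e, he⟩ := exists_perm_exchange (n := n) (by omega) hjn hy.1 hy.2 hx hxj
    rw [hcard, hcard]
    congr 2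
    refine Finset.card_equiv e fun σ => ?_
    have hp : relRankPrefix n (permRank n) j (e σ) = relRankPrefix n (permRank n) j σ := by
      funext i
      unfold relRankPrefix
      split_ifs with hi
      · rw [Finset.mem_Icc] at hi
        exact (he σ).1 i hi.1 (by omega) (by omega)
      · rfl
    simp only [Finset.mem_filter, Finset.mem_univ, true_and, hp, (he σ).2]
  rw [← sum_prob_relRank_eq_all hR (by omega : 1 ≤ j + 1) hjn
    ((relRankFiltration hR).le j _ hA), Finset.sum_congr rfl hconst]
  simp

/-- On an event of `F_k` on which the `j`-th candidate is ranked `x` among the first `k`, this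
candidate is the third best with conditional probability `gain n k x`. -/
theorem prob_rank_eq_three (hn : 3 ≤ n) (hR : IsUniformRanking n P R) {j k x : ℕ} (hj : 1 ≤ j)
    (hjk : j ≤ k) (hkn : k ≤ n) (hx : 1 ≤ x) (hxk : x ≤ k) {A : Set Ω}
    (hA : MeasurableSet[relRankFiltration hR k] A)
    (hAx : ∀ ω ∈ A, ∀ σ, ω ∈ rankingEvent n R σ → rankAmong R k j ω = x) :
    P.real (A ∩ {ω | R j ω = 3}) = gain n k x * P.real A := by
  induction hkn using Nat.decreasingInduction generalizing A x with
  | self =>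
    rw [gain_last x hn]
    have hae : ∀ᵐ ω ∂P, ω ∈ A → R j ω = x := by
      filter_upwards [ae_mem_rankingEvent hR] with ω ⟨σ, hσ⟩ hωA
      rw [← hAx ω hωA σ hσ, rankAmong_last hσ hj hjk]
    split_ifs with h3
    · rw [one_mul]
      refine measureReal_congr ?_
      filter_upwards [hae] with ω hω
      refine propext ⟨fun h => h.1, fun h => ⟨h, ?_⟩⟩
      exact (hω h).trans h3
    · rw [zero_mul, measureReal_def]
      have : P (A ∩ {ω | R j ω = 3}) = 0 := by
        rw [measure_eq_zero_iff_ae_notMem]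
        filter_upwards [hae] with ω hω h
        exact h3 ((hω h.1).symm.trans h.2)
      rw [this, ENNReal.toReal_zero]
  | of_succ k hk ih =>
    have hAm := (relRankFiltration hR).le k _ hA
    have hA' := (relRankFiltration hR).mono (Nat.le_succ k) _ hA
    have hE : MeasurableSet[relRankFiltration hR (k + 1)]
        {ω | relRank R (k + 1) ω ∈ Finset.Icc 1 x} :=
      measurableSet_relRank_eq hR (by omega) le_rfl hk (Finset.Icc 1 x : Finset ℕ)
    have hEm := (relRankFiltration hR).le (k + 1) _ hE
    have hstep : ∀ ω ∈ A, ∀ σ, ω ∈ rankingEvent n R σ → rankAmong R (k + 1) j ω =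
        x + if relRank R (k + 1) ω ∈ Finset.Icc 1 x then 1 else 0 := by
      intro ω hω σ hσ
      have hsub : (Finset.Icc 1 (k + 1) : Set ℕ) ⊆ Finset.Icc 1 n := by
        exact_mod_cast Finset.Icc_subset_Icc_right hk
      rw [rankAmong_succ ((rank_injOn hσ).mono hsub) hj hjk, hAx ω hω σ hσ]
      simp [one_le_relRank R (Nat.succ_pos k) ω]
    have h1 := ih (x := x + 1) (by omega) (by omega) (by omega) (hA'.inter hE) (by
      intro ω hω σ hσ
      have hE : relRank R (k + 1) ω ∈ Finset.Icc 1 x := hω.2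
      rw [hstep ω hω.1 σ hσ, if_pos hE])
    have h2 := ih (x := x) (by omega) hx (by omega) (hA'.diff hE) (by
      intro ω hω σ hσ
      have hE : relRank R (k + 1) ω ∉ Finset.Icc 1 x := hω.2
      rw [hstep ω hω.1 σ hσ, if_neg hE, add_zero])
    have hP : ((k : ℝ) + 1) * P.real (A ∩ {ω | relRank R (k + 1) ω ∈ Finset.Icc 1 x}) =
        x * P.real A := by
      rw [← sum_prob_relRank_eq hR (by omega) hk hAm, Finset.mul_sum]
      rw [Finset.sum_congr rfl fun y hy => prob_relRank_succ hR hk (Finset.mem_Icc.1 hy).1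
        (by have := (Finset.mem_Icc.1 hy).2; omega) hA]
      simp
    have hsplit := measureReal_inter_add_sdiff (μ := P) (s := A) hEm
    have hsplit' := measureReal_inter_add_sdiff (μ := P) (s := A ∩ {ω | R j ω = 3}) hEm
    have hdiff : (A ∩ {ω | R j ω = 3}) \ {ω | relRank R (k + 1) ω ∈ Finset.Icc 1 x} =
        A \ {ω | relRank R (k + 1) ω ∈ Finset.Icc 1 x} ∩ {ω | R j ω = 3} := by
      ext ω
      simp only [Set.mem_sdiff, Set.mem_inter_iff]
      tauto
    rw [Set.inter_right_comm, h1, hdiff, h2] at hsplit'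
    have hrec := gain_recursion (n := n) (k := k) hx
    have hk1 : (k : ℝ) + 1 ≠ 0 := by positivity
    refine mul_left_cancel₀ hk1 ?_
    rw [← mul_assoc, hrec, ← hsplit']
    linear_combination (gain n (k + 1) (x + 1) - gain n (k + 1) x) * hP +
      ((k : ℝ) + 1) * gain n (k + 1) x * hsplit

end Law

/-! ### Optimality -/

section Optimality

variable {Ω : Type*} [MeasurableSpace Ω] {P : Measure Ω} {R : ℕ → Ω → ℕ} {n : ℕ} {τ : Ω → ℕ}

theorem IsStoppingRule.measurableSet_eq {hR : IsUniformRanking n P R} (hτ : IsStoppingRule hR τ)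
    (j : ℕ) : MeasurableSet[relRankFiltration hR j] {ω | τ ω = j} := by
  refine (congrArg (MeasurableSet[relRankFiltration hR j]) ?_).mp
    (hτ.2.measurableSet_eq_of_countable j)
  ext ω
  exact WithTop.coe_inj

theorem IsStoppingRule.measurableSet_gt {hR : IsUniformRanking n P R} (hτ : IsStoppingRule hR τ)
    (j : ℕ) : MeasurableSet[relRankFiltration hR j] {ω | j < τ ω} := by
  refine (congrArg (MeasurableSet[relRankFiltration hR j]) ?_).mp (hτ.2.measurableSet_gt j)
  ext ω
  exact WithTop.coe_lt_coe

variable [IsProbabilityMeasure P]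

theorem prob_eq_inter_three (hn : 3 ≤ n) {hR : IsUniformRanking n P R}
    (hτ : IsStoppingRule hR τ) {j : ℕ} (hj : 1 ≤ j) (hjn : j ≤ n) :
    P.real ({ω | τ ω = j} ∩ {ω | R j ω = 3}) =
      ∑ x ∈ Finset.Icc 1 j, gain n j x * P.real ({ω | τ ω = j} ∩ {ω | relRank R j ω = x}) := by
  have hB := hτ.measurableSet_eq j
  have h3 : MeasurableSet {ω | R j ω = 3} :=
    hR.measurable j hj hjn (measurableSet_singleton 3)
  rw [← sum_prob_relRank_eq_all hR hj hjn (((relRankFiltration hR).le j _ hB).inter h3)]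
  refine Finset.sum_congr rfl fun x hx => ?_
  rw [Finset.mem_Icc] at hx
  rw [Set.inter_right_comm]
  refine prob_rank_eq_three hn hR hj le_rfl hjn hx.1 hx.2
    (hB.inter (measurableSet_relRank_eq hR hj le_rfl hjn {x})) ?_
  intro ω hω _ _
  exact hω.2

/-- One step of backward induction: the difference between the value before and after the `j`-th
interview is the sum over the relative ranks `x` of the loss of the decision made at `x`. -/
theorem backward_step (hn : 3 ≤ n) {hR : IsUniformRanking n P R} (hτ : IsStoppingRule hR τ)
    {j : ℕ} (hjn : j < n) :
    value n (j + 1) * P.real {ω | j < τ ω} -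
        (P.real ({ω | τ ω = j + 1} ∩ {ω | R (j + 1) ω = 3}) +
          value n (j + 2) * P.real {ω | j + 1 < τ ω}) =
      ∑ x ∈ Finset.Icc 1 (j + 1),
        ((max (gain n (j + 1) x) (value n (j + 2)) - gain n (j + 1) x) *
            P.real ({ω | τ ω = j + 1} ∩ {ω | relRank R (j + 1) ω = x}) +
          (max (gain n (j + 1) x) (value n (j + 2)) - value n (j + 2)) *
            P.real ({ω | j + 1 < τ ω} ∩ {ω | relRank R (j + 1) ω = x})) := by
  have hA := hτ.measurableSet_gt j
  have hj1 : (j : ℝ) + 1 ≠ 0 := by positivity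
  have hV : value n (j + 1) * P.real {ω | j < τ ω} = ∑ x ∈ Finset.Icc 1 (j + 1),
      max (gain n (j + 1) x) (value n (j + 2)) *
        P.real ({ω | j < τ ω} ∩ {ω | relRank R (j + 1) ω = x}) := by
    refine mul_left_cancel₀ hj1 ?_
    have hm := mul_value (n := n) (j := j + 1) (by omega) hjn
    push_cast at hm
    rw [← mul_assoc, hm, Finset.sum_mul, Finset.mul_sum]
    refine Finset.sum_congr rfl fun x hx => ?_
    rw [Finset.mem_Icc] at hx
    rw [← prob_relRank_succ hR hjn hx.1 hx.2 hA]
    ring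
  have hsplit : ∀ x, P.real ({ω | j < τ ω} ∩ {ω | relRank R (j + 1) ω = x}) =
      P.real ({ω | τ ω = j + 1} ∩ {ω | relRank R (j + 1) ω = x}) +
        P.real ({ω | j + 1 < τ ω} ∩ {ω | relRank R (j + 1) ω = x}) := by
    intro x
    have hX : MeasurableSet {ω | relRank R (j + 1) ω = x} :=
      hR.measurable_relRank (by omega) hjn (measurableSet_singleton x)
    rw [← measureReal_union ?_
      (((relRankFiltration hR).le _ _ (hτ.measurableSet_gt (j + 1))).inter hX),
      ← Set.union_inter_distrib_right]
    · congr 2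
      ext ω
      simp only [Set.mem_ofPred_eq, Set.mem_union]
      omega
    · refine Set.disjoint_left.2 fun ω h h' => ?_
      have h1 : τ ω = j + 1 := h.1
      have h2 : j + 1 < τ ω := h'.1
      omega
  rw [hV, prob_eq_inter_three hn hτ (by omega) hjn,
    ← sum_prob_relRank_eq_all hR (by omega : 1 ≤ j + 1) hjn
      ((relRankFiltration hR).le _ _ (hτ.measurableSet_gt (j + 1))),
    Finset.mul_sum, ← Finset.sum_add_distrib, ← Finset.sum_sub_distrib]
  refine Finset.sum_congr rfl fun x _ => ?_
  rw [hsplit]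
  ring

theorem probThird_eq_sum {hR : IsUniformRanking n P R} (hτ : IsStoppingRule hR τ) :
    (probThird P R τ).toReal =
      ∑ j ∈ Finset.range n, P.real ({ω | τ ω = j + 1} ∩ {ω | R (j + 1) ω = 3}) := by
  rw [← measureReal_biUnion_finset]
  · rw [probThird, measureReal_def]
    congr 2
    ext ω
    have h := hτ.1 ω
    simp only [Set.mem_ofPred_eq, Set.mem_iUnion, Finset.mem_range, Set.mem_inter_iff, exists_prop]
    constructor
    · intro h3
      have e : τ ω - 1 + 1 = τ ω := by omega
      exact ⟨τ ω - 1, by omega, e.symm, by rwa [e]⟩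
    · rintro ⟨j, -, hj, h3⟩
      rwa [hj]
  · intro i _ j _ hij
    refine Set.disjoint_left.2 fun ω h h' => hij ?_
    have := h.1.symm.trans h'.1
    omega
  · intro j hj
    rw [Finset.mem_range] at hj
    exact ((relRankFiltration hR).le _ _ (hτ.measurableSet_eq (j + 1))).inter
      (hR.measurable (j + 1) (by omega) hj (measurableSet_singleton 3))

/-- The value minus the probability of success of a rule is the sum of its losses. -/
theorem value_one_sub_probThird {hR : IsUniformRanking n P R} (hτ : IsStoppingRule hR τ) :
    value n 1 - (probThird P R τ).toReal =
      ∑ j ∈ Finset.range n, (value n (j + 1) * P.real {ω | j < τ ω} -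
        (P.real ({ω | τ ω = j + 1} ∩ {ω | R (j + 1) ω = 3}) +
          value n (j + 2) * P.real {ω | j + 1 < τ ω})) := by
  have htel := Finset.sum_range_sub' (fun j => value n (j + 1) * P.real {ω | j < τ ω}) n
  have h0 : {ω | 0 < τ ω} = Set.univ := Set.eq_univ_of_forall fun ω => (hτ.1 ω).1
  simp only [h0, value_succ_self, zero_add, zero_mul, sub_zero, probReal_univ, mul_one] at htel
  rw [probThird_eq_sum hτ, ← htel, ← Finset.sum_sub_distrib]
  refine Finset.sum_congr rfl fun j _ => ?_
  rw [add_assoc]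
  ring

theorem probThird_le_value (hn : 3 ≤ n) {hR : IsUniformRanking n P R}
    (hτ : IsStoppingRule hR τ) : (probThird P R τ).toReal ≤ value n 1 := by
  rw [← sub_nonneg, value_one_sub_probThird hτ]
  refine Finset.sum_nonneg fun j hj => ?_
  rw [backward_step hn hτ (Finset.mem_range.1 hj)]
  refine Finset.sum_nonneg fun x _ => ?_
  exact add_nonneg (mul_nonneg (sub_nonneg.2 (le_max_left _ _)) measureReal_nonneg)
    (mul_nonneg (sub_nonneg.2 (le_max_right _ _)) measureReal_nonneg)

/-- A rule whose decisions agree with the stopping region (where it is forced to stop at time `n`)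
has no losses. -/
theorem probThird_eq_value (hn : 3 ≤ n) {hR : IsUniformRanking n P R}
    (hτ : IsStoppingRule hR τ)
    (hregion : ∀ ω j, τ ω = j → j < n → InStopRegion n j (relRank R j ω))
    (hcont : ∀ ω j, 1 ≤ j → j < τ ω → ¬ InStopRegion n j (relRank R j ω)) :
    (probThird P R τ).toReal = value n 1 := by
  symm
  rw [← sub_eq_zero, value_one_sub_probThird hτ]
  refine Finset.sum_eq_zero fun j hj => ?_
  rw [Finset.mem_range] at hj
  rw [backward_step hn hτ hj]
  refine Finset.sum_eq_zero fun x hx => ?_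
  rw [Finset.mem_Icc] at hx
  have h1 : (max (gain n (j + 1) x) (value n (j + 2)) - gain n (j + 1) x) *
      P.real ({ω | τ ω = j + 1} ∩ {ω | relRank R (j + 1) ω = x}) = 0 := by
    rcases Set.eq_empty_or_nonempty ({ω | τ ω = j + 1} ∩ {ω | relRank R (j + 1) ω = x}) with
      h | ⟨ω, h, rfl⟩
    · rw [h, measureReal_empty, mul_zero]
    · rw [max_eq_left, sub_self, zero_mul]
      rcases eq_or_lt_of_le (Nat.succ_le_of_lt hj) with e | hlt
      · subst e
        exact value_le_gain_last _ hn
      · exact value_le_gain hn hj (hregion ω _ h hlt)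
  have h2 : (max (gain n (j + 1) x) (value n (j + 2)) - value n (j + 2)) *
      P.real ({ω | j + 1 < τ ω} ∩ {ω | relRank R (j + 1) ω = x}) = 0 := by
    rcases Set.eq_empty_or_nonempty ({ω | j + 1 < τ ω} ∩ {ω | relRank R (j + 1) ω = x}) with
      h | ⟨ω, h, rfl⟩
    · rw [h, measureReal_empty, mul_zero]
    · rw [max_eq_right, sub_self, zero_mul]
      exact gain_le_value hn (by omega) hj hx.1 (hcont ω _ (by omega) h)
  rw [h1, h2, add_zero]

end Optimality

/-! ### The two-threshold rule -/

section TwoThreshold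

variable {Ω : Type*} {R : ℕ → Ω → ℕ} {n : ℕ} {ω : Ω}

theorem firstTime_le (n : ℕ) (R : ℕ → Ω → ℕ) (c x : ℕ) (ω : Ω) : firstTime n R c x ω ≤ n := by
  unfold firstTime minOr
  split_ifs with h
  · have := Finset.min'_mem _ h
    rw [Finset.mem_filter, Finset.mem_Icc] at this
    exact this.1.2
  · exact le_rfl

theorem firstTime_le_iff {c x j : ℕ} (hjn : j < n) :
    firstTime n R c x ω ≤ j ↔ ∃ i, c ≤ i ∧ i ≤ j ∧ relRank R i ω = x := by
  unfold firstTime minOr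
  split_ifs with h
  · constructor
    · intro h4
      have hm := Finset.min'_mem _ h
      rw [Finset.mem_filter, Finset.mem_Icc] at hm
      exact ⟨_, hm.1.1, h4, hm.2⟩
    · rintro ⟨i, h1, h4, h3⟩
      refine (Finset.min'_le _ i ?_).trans h4
      rw [Finset.mem_filter, Finset.mem_Icc]
      exact ⟨⟨h1, by omega⟩, h3⟩
  · refine iff_of_false (by omega) ?_
    rintro ⟨i, h1, h4, h3⟩
    exact h ⟨i, by rw [Finset.mem_filter, Finset.mem_Icc]; exact ⟨⟨h1, by omega⟩, h3⟩⟩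

theorem tau3_le (n : ℕ) (R : ℕ → Ω → ℕ) (ω : Ω) : tau3 n R ω ≤ n :=
  (min_le_left _ _).trans (firstTime_le _ _ _ _ _)

theorem tau3_le_iff {j : ℕ} (hjn : j < n) :
    tau3 n R ω ≤ j ↔ ∃ i ≤ j, InStopRegion n i (relRank R i ω) := by
  rw [tau3, min_le_iff, firstTime_le_iff hjn, firstTime_le_iff hjn]
  unfold InStopRegion
  grind

theorem tau3_mem_stopRegion (h : tau3 n R ω < n) :
    InStopRegion n (tau3 n R ω) (relRank R (tau3 n R ω) ω) := by
  obtain ⟨i, hi, hs⟩ := (tau3_le_iff h).1 le_rfl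
  have := (tau3_le_iff (hi.trans_lt h)).2 ⟨i, le_rfl, hs⟩
  rwa [le_antisymm this hi]

theorem not_mem_stopRegion_of_lt_tau3 {j : ℕ} (h : j < tau3 n R ω) :
    ¬ InStopRegion n j (relRank R j ω) := fun hs =>
  h.not_ge ((tau3_le_iff (h.trans_le (tau3_le n R ω))).2 ⟨j, le_rfl, hs⟩)

theorem one_le_of_inStopRegion (hn : 3 ≤ n) {j x : ℕ} (h : InStopRegion n j x) : 1 ≤ j := by
  have := two_le_a hn
  have := a_lt_b hn
  unfold InStopRegion at h
  omega

theorem isStoppingRule_tau3 [MeasurableSpace Ω] {P : Measure Ω} (hn : 3 ≤ n)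
    (hR : IsUniformRanking n P R) : IsStoppingRule hR (tau3 n R) := by
  refine ⟨fun ω => ⟨?_, tau3_le n R ω⟩, fun j => ?_⟩
  · rcases (tau3_le n R ω).eq_or_lt with h | h
    · omega
    · exact one_le_of_inStopRegion hn (tau3_mem_stopRegion h)
  · have hcoe : {ω | ((tau3 n R ω : ℕ) : WithTop ℕ) ≤ WithTop.some j} = {ω | tau3 n R ω ≤ j} := by
      ext ω
      exact WithTop.coe_le_coe
    refine (congrArg (MeasurableSet[relRankFiltration hR j]) hcoe).mpr ?_
    rcases le_or_gt n j with h | h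
    · have : {ω | tau3 n R ω ≤ j} = Set.univ :=
        Set.eq_univ_of_forall fun ω => (tau3_le n R ω).trans h
      rw [this]
      exact MeasurableSet.univ
    · have : {ω | tau3 n R ω ≤ j} =
          ⋃ i ∈ Finset.Icc 1 j, {ω | relRank R i ω ∈ {x | InStopRegion n i x}} := by
        ext ω
        simp only [Set.mem_ofPred_eq, Set.mem_iUnion, Finset.mem_Icc, exists_prop]
        rw [tau3_le_iff h]
        exact ⟨fun ⟨i, hi, hs⟩ => ⟨i, ⟨one_le_of_inStopRegion hn hs, hi⟩, hs⟩,
          fun ⟨i, hi, hs⟩ => ⟨i, hi.2, hs⟩⟩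
      rw [this]
      refine Finset.measurableSet_biUnion _ fun i hi => ?_
      rw [Finset.mem_Icc] at hi
      exact measurableSet_relRank_eq hR hi.1 hi.2 (by omega) _

end TwoThreshold

end ThirdBest

end

theorem theorem2p1 (n : ℕ) (hn : 3 ≤ n) :
    -- the minima that define the thresholds exist
    IsLeast (ThirdBest.bSet n) (ThirdBest.b n) ∧
    IsLeast (ThirdBest.aSet n) (ThirdBest.a n) ∧
    -- `f_n` has two distinct real roots and `a_n` is the ceiling of the smaller one
    (∃ x₀ y₀ : ℝ, x₀ < y₀ ∧
      (∀ x : ℝ, ThirdBest.f n x = 0 ↔ x = x₀ ∨ x = y₀) ∧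
      ((ThirdBest.a n : ℕ) : ℤ) = ⌈x₀⌉) ∧
    ThirdBest.a n < ThirdBest.b n ∧
    -- the two-threshold rule is a stopping rule and is optimal among all stopping rules
    ∀ (Ω : Type*) [MeasurableSpace Ω] (P : MeasureTheory.Measure Ω)
      [MeasureTheory.IsProbabilityMeasure P] (R : ℕ → Ω → ℕ)
      (hR : ThirdBest.IsUniformRanking n P R),
      ThirdBest.IsStoppingRule hR (ThirdBest.tau3 n R) ∧
      ∀ τ : Ω → ℕ, ThirdBest.IsStoppingRule hR τ →
        ThirdBest.probThird P R τ ≤ ThirdBest.probThird P R (ThirdBest.tau3 n R) := by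
  refine ⟨ThirdBest.isLeast_b hn, ThirdBest.isLeast_a hn, ThirdBest.exists_roots_f hn,
    ThirdBest.a_lt_b hn, fun Ω _ P _ R hR => ⟨ThirdBest.isStoppingRule_tau3 hn hR, fun τ hτ => ?_⟩⟩
  have hopt := ThirdBest.probThird_eq_value hn (ThirdBest.isStoppingRule_tau3 hn hR)
    (fun ω j hj hjn => hj ▸ ThirdBest.tau3_mem_stopRegion (hj.trans_lt hjn))
    (fun ω j _ hj => ThirdBest.not_mem_stopRegion_of_lt_tau3 hj)
  refine (ENNReal.toReal_le_toReal ?_ ?_).1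
    ((ThirdBest.probThird_le_value hn hτ).trans hopt.ge)
  · exact MeasureTheory.measure_ne_top _ _
  · exact MeasureTheory.measure_ne_top _ _
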